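/- Let $\epsilon\ge 0$ and let $$C(\mathbb T^2)_\epsilon = C^*\langle u,v \mid u \text{ and } v \text{ are unitaries and } \|uv-vu\|\le\epsilon\rangle$$ be the soft torus, i.e. the universal unital C*-algebra generated by two unitaries $u,v$ with $\|uv-vu\|\le\epsilon$. Then $C(\mathbb T^2)_\epsilon$ is residually finite-dimensional: it has a separating family of finite-dimensional representations, that is, for every nonzero $a\in C(\mathbb T^2)_\epsilon$ there are $n\in\mathbb N$ and a $*$-homomorphism $\pi: C(\mathbb T^2)_\epsilon\to M_n(\mathbb C)$ with $\pi(a)\ne 0$. -/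

import Mathlib

noncomputable section

namespace SoftTorus

/-! ### The complex group algebra of the free group on two generators, as a `*`-algebra -/

/-- The complex group `*`-algebra `ℂ[F₂]` of the free group on two generators: the universal unital
complex `*`-algebra generated by two unitaries. -/
def FreeStarAlg : Type := MonoidAlgebra ℂ (FreeGroup (Fin 2))

namespace FreeStarAlg

instance : Ring FreeStarAlg := inferInstanceAs (Ring (MonoidAlgebra ℂ (FreeGroup (Fin 2))))

instance : Algebra ℂ FreeStarAlg :=
  inferInstanceAs (Algebra ℂ (MonoidAlgebra ℂ (FreeGroup (Fin 2))))

/-- The element `c · g` of `ℂ[F₂]`. -/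
def single (g : FreeGroup (Fin 2)) (c : ℂ) : FreeStarAlg := MonoidAlgebra.single g c

theorem single_add (g : FreeGroup (Fin 2)) (c d : ℂ) :
    single g (c + d) = single g c + single g d := MonoidAlgebra.single_add g c d

theorem single_zero (g : FreeGroup (Fin 2)) : single g 0 = 0 := MonoidAlgebra.single_zero g

theorem single_mul_single (g h : FreeGroup (Fin 2)) (c d : ℂ) :
    single g c * single h d = single (g * h) (c * d) := MonoidAlgebra.single_mul_single g h c d

theorem one_def : (1 : FreeStarAlg) = single 1 1 := MonoidAlgebra.one_def

theorem smul_single (c : ℂ) (g : FreeGroup (Fin 2)) (d : ℂ) :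
    c • single g d = single g (c * d) := MonoidAlgebra.smul_single c g d

theorem induction {P : FreeStarAlg → Prop} (a : FreeStarAlg)
    (hadd : ∀ x y, P x → P y → P (x + y)) (hsingle : ∀ g c, P (single g c)) : P a := by
  refine MonoidAlgebra.induction_on (motive := fun a ↦ P a ∧ ∀ r : ℂ, P (r • (a : FreeStarAlg))) a
    ?_ ?_ ?_ |>.1
  · intro m
    exact ⟨hsingle m 1, fun r ↦ by
      have := hsingle m (r * 1)
      rwa [← smul_single] at this⟩
  · intro x y hx hy
    exact ⟨hadd _ _ hx.1 hy.1, fun r ↦ by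
      have h := smul_add r (x : FreeStarAlg) (y : FreeStarAlg)
      exact h ▸ hadd _ _ (hx.2 r) (hy.2 r)⟩
  · intro r x hx
    refine ⟨hx.2 r, fun s ↦ ?_⟩
    have := hx.2 (s * r)
    rwa [mul_smul] at this

/-- The involution `(∑ c_g g)⋆ = ∑ conj(c_g) g⁻¹`, as an additive map. -/
def starHom : FreeStarAlg →+ FreeStarAlg :=
  (Finsupp.liftAddHom (fun g : FreeGroup (Fin 2) ↦
    ({ toFun := fun c ↦ single g⁻¹ (starRingEnd ℂ c)
       map_zero' := by simp [single_zero]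
       map_add' := fun c d ↦ by simp [single_add] } : ℂ →+ FreeStarAlg))).comp
    (MonoidAlgebra.coeffAddEquiv.toAddMonoidHom :
      MonoidAlgebra ℂ (FreeGroup (Fin 2)) →+ (FreeGroup (Fin 2) →₀ ℂ))

theorem starHom_single (g : FreeGroup (Fin 2)) (c : ℂ) :
    starHom (single g c) = single g⁻¹ (starRingEnd ℂ c) := by
  exact (Finsupp.liftAddHom_apply_single _ g c).trans rfl

instance : StarRing FreeStarAlg where
  star := starHom
  star_involutive a := by
    induction a using induction with
    | hadd x y hx hy => rw [map_add, map_add, hx, hy]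
    | hsingle g c => rw [starHom_single, starHom_single]; simp
  star_add := map_add starHom
  star_mul a b := by
    induction a using induction with
    | hadd x y hx hy => rw [add_mul, map_add, map_add, hx, hy, mul_add]
    | hsingle g c =>
      induction b using induction with
      | hadd x y hx hy => rw [mul_add, map_add, map_add, hx, hy, add_mul]
      | hsingle h d =>
        simp only [single_mul_single, starHom_single, mul_inv_rev, map_mul]
        rw [mul_comm]

theorem star_single (g : FreeGroup (Fin 2)) (c : ℂ) :
    star (single g c) = single g⁻¹ (starRingEnd ℂ c) := starHom_single g c

instance : StarModule ℂ FreeStarAlg where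
  star_smul r a := by
    induction a using induction with
    | hadd x y hx hy => rw [smul_add, star_add, hx, hy, star_add, smul_add]
    | hsingle g c => simp [smul_single, star_single]

/-- The two canonical generators `u = gen 0` and `v = gen 1`. -/
def gen (i : Fin 2) : FreeStarAlg := single (FreeGroup.of i) 1

end FreeStarAlg

open FreeStarAlg

/-! ### The soft torus -/

/-- `p` is a C⋆-seminorm on `ℂ[F₂]` with `p (u v - v u) ≤ ε`. -/
structure IsAdmissible (ε : ℝ) (p : Seminorm ℂ FreeStarAlg) : Prop where
  mul_le : ∀ a b, p (a * b) ≤ p a * p b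
  star_mul_self : ∀ a, p (star a * a) = p a ^ 2
  comm_le : p (gen 0 * gen 1 - gen 1 * gen 0) ≤ ε

theorem IsAdmissible.one_le {ε : ℝ} {p : Seminorm ℂ FreeStarAlg} (hp : IsAdmissible ε p) :
    p 1 ≤ 1 := by
  have h := hp.star_mul_self 1
  rw [star_one, one_mul] at h
  nlinarith [apply_nonneg p 1]

theorem IsAdmissible.single_le {ε : ℝ} {p : Seminorm ℂ FreeStarAlg} (hp : IsAdmissible ε p)
    (g : FreeGroup (Fin 2)) (c : ℂ) : p (single g c) ≤ ‖c‖ := by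
  have h1 : p (single g 1) ≤ 1 := by
    have h := hp.star_mul_self (single g 1)
    rw [star_single, single_mul_single, map_one, mul_one, inv_mul_cancel, ← one_def] at h
    nlinarith [apply_nonneg p (single g 1), hp.one_le]
  have h2 : single g c = c • single g 1 := by rw [smul_single, mul_one]
  rw [h2, map_smul_eq_mul]
  nlinarith [norm_nonneg c]

theorem IsAdmissible.bounded (ε : ℝ) (a : FreeStarAlg) :
    ∃ C : ℝ, ∀ p : Seminorm ℂ FreeStarAlg, IsAdmissible ε p → p a ≤ C := by
  induction a using FreeStarAlg.induction with
  | hadd x y hx hy =>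
    obtain ⟨C, hC⟩ := hx
    obtain ⟨D, hD⟩ := hy
    exact ⟨C + D, fun p hp ↦ (map_add_le_add p x y).trans (add_le_add (hC p hp) (hD p hp))⟩
  | hsingle g c => exact ⟨‖c‖, fun p hp ↦ hp.single_le g c⟩

/-- The universal C⋆-seminorm on `ℂ[F₂]` subject to `‖u v - v u‖ ≤ ε`: the supremum of all
admissible C⋆-seminorms. -/
def univNorm (ε : ℝ) (a : FreeStarAlg) : ℝ :=
  ⨆ p : {p : Seminorm ℂ FreeStarAlg // IsAdmissible ε p}, p.1 a

theorem le_univNorm {ε : ℝ} {p : Seminorm ℂ FreeStarAlg} (hp : IsAdmissible ε p)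
    (a : FreeStarAlg) : p a ≤ univNorm ε a := by
  obtain ⟨C, hC⟩ := IsAdmissible.bounded ε a
  exact le_ciSup (f := fun p : {p : Seminorm ℂ FreeStarAlg // IsAdmissible ε p} ↦ p.1 a)
    ⟨C, by rintro _ ⟨q, rfl⟩; exact hC q.1 q.2⟩ ⟨p, hp⟩

theorem univNorm_nonneg (ε : ℝ) (a : FreeStarAlg) : 0 ≤ univNorm ε a :=
  Real.iSup_nonneg fun p ↦ apply_nonneg p.1 a

theorem univNorm_le {ε : ℝ} {a : FreeStarAlg} {C : ℝ} (hC : 0 ≤ C)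
    (h : ∀ p : Seminorm ℂ FreeStarAlg, IsAdmissible ε p → p a ≤ C) : univNorm ε a ≤ C :=
  Real.iSup_le (fun p ↦ h p.1 p.2) hC

theorem univNorm_zero (ε : ℝ) : univNorm ε 0 = 0 :=
  le_antisymm (univNorm_le le_rfl fun p _ ↦ (map_zero p).le) (univNorm_nonneg ε 0)

theorem univNorm_add_le (ε : ℝ) (a b : FreeStarAlg) :
    univNorm ε (a + b) ≤ univNorm ε a + univNorm ε b :=
  univNorm_le (add_nonneg (univNorm_nonneg ε a) (univNorm_nonneg ε b)) fun p hp ↦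
    (map_add_le_add p a b).trans (add_le_add (le_univNorm hp a) (le_univNorm hp b))

theorem univNorm_smul_le (ε : ℝ) (c : ℂ) (a : FreeStarAlg) :
    univNorm ε (c • a) ≤ ‖c‖ * univNorm ε a :=
  univNorm_le (mul_nonneg (norm_nonneg c) (univNorm_nonneg ε a)) fun p hp ↦ by
    rw [map_smul_eq_mul]
    exact mul_le_mul_of_nonneg_left (le_univNorm hp a) (norm_nonneg c)

theorem univNorm_neg (ε : ℝ) (a : FreeStarAlg) : univNorm ε (-a) = univNorm ε a := by
  simp only [univNorm, map_neg_eq_map]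

theorem univNorm_mul_le (ε : ℝ) (a b : FreeStarAlg) :
    univNorm ε (a * b) ≤ univNorm ε a * univNorm ε b :=
  univNorm_le (mul_nonneg (univNorm_nonneg ε a) (univNorm_nonneg ε b)) fun p hp ↦
    (hp.mul_le a b).trans
      (mul_le_mul (le_univNorm hp a) (le_univNorm hp b) (apply_nonneg p b) (univNorm_nonneg ε a))

theorem univNorm_mul_self_le (ε : ℝ) (a : FreeStarAlg) :
    univNorm ε a * univNorm ε a ≤ univNorm ε (star a * a) := by
  have h : univNorm ε a ≤ √(univNorm ε (star a * a)) :=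
    univNorm_le (Real.sqrt_nonneg _) fun p hp ↦
      Real.le_sqrt_of_sq_le ((hp.star_mul_self a).symm.le.trans (le_univNorm hp _))
  calc univNorm ε a * univNorm ε a
      ≤ √(univNorm ε (star a * a)) * √(univNorm ε (star a * a)) :=
        mul_self_le_mul_self (univNorm_nonneg ε a) h
    _ = univNorm ε (star a * a) := Real.mul_self_sqrt (univNorm_nonneg ε _)

theorem univNorm_star_le (ε : ℝ) (a : FreeStarAlg) : univNorm ε (star a) ≤ univNorm ε a := by
  have h1 := univNorm_mul_self_le ε (star a)
  rw [star_star] at h1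
  have h2 := h1.trans (univNorm_mul_le ε a (star a))
  rcases (univNorm_nonneg ε (star a)).eq_or_lt with h | h
  · rw [← h]; exact univNorm_nonneg ε a
  · exact le_of_mul_le_mul_right h2 h

/-- `ℂ[F₂]`, equipped with the seminorm `univNorm ε`. -/
def Pre (_ε : ℝ) : Type := FreeStarAlg

namespace Pre

variable {ε : ℝ}

instance : Ring (Pre ε) := inferInstanceAs (Ring FreeStarAlg)
instance : Algebra ℂ (Pre ε) := inferInstanceAs (Algebra ℂ FreeStarAlg)
instance : StarRing (Pre ε) := inferInstanceAs (StarRing FreeStarAlg)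
instance : StarModule ℂ (Pre ε) := inferInstanceAs (StarModule ℂ FreeStarAlg)

/-- The universal seminorm, bundled. -/
def ringSeminorm (ε : ℝ) : RingSeminorm (Pre ε) where
  toFun := univNorm ε
  map_zero' := univNorm_zero ε
  add_le' := univNorm_add_le ε
  neg' := univNorm_neg ε
  mul_le' := univNorm_mul_le ε

instance : SeminormedRing (Pre ε) where
  __ := (inferInstance : Ring (Pre ε))
  __ := (ringSeminorm ε).toAddGroupSeminorm.toSeminormedAddCommGroup
  norm_mul_le := univNorm_mul_le ε

theorem norm_def (a : Pre ε) : ‖a‖ = univNorm ε a := rfl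

instance : NormedAlgebra ℂ (Pre ε) where
  norm_smul_le := univNorm_smul_le ε

theorem norm_star_le (a : Pre ε) : ‖star a‖ ≤ ‖a‖ := univNorm_star_le ε a

instance : NormedStarGroup (Pre ε) where
  norm_star_le := norm_star_le

theorem norm_mul_self_le (a : Pre ε) : ‖a‖ * ‖a‖ ≤ ‖star a * a‖ := univNorm_mul_self_le ε a

theorem uniformContinuous_star : UniformContinuous (star : Pre ε → Pre ε) :=
  (AddMonoidHomClass.isometry_of_norm (starAddEquiv : Pre ε ≃+ Pre ε)
    (fun a ↦ norm_star a)).uniformContinuous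

end Pre

end SoftTorus

/-- The soft torus `C(𝕋²)_ε`, i.e. the universal C⋆-algebra
`C⋆⟨u, v | u and v are unitaries and ‖u v - v u‖ ≤ ε⟩`: the Hausdorff completion of `ℂ[F₂]` in the
largest C⋆-seminorm `p` satisfying `p (u v - v u) ≤ ε`. -/
abbrev SoftTorus (ε : ℝ) : Type := UniformSpace.Completion (SoftTorus.Pre ε)

namespace SoftTorus

open UniformSpace UniformSpace.Completion FreeStarAlg

variable {ε : ℝ}

instance : StarRing (SoftTorus ε) where
  star := Completion.map star
  star_involutive a := by
    induction a using Completion.induction_on with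
    | hp => exact isClosed_eq (continuous_map.comp continuous_map) continuous_id
    | ih a => rw [map_coe Pre.uniformContinuous_star, map_coe Pre.uniformContinuous_star, star_star]
  star_add a b := by
    induction a, b using Completion.induction_on₂ with
    | hp =>
      exact isClosed_eq (continuous_map.comp continuous_add)
        (Continuous.add (continuous_map.comp continuous_fst) (continuous_map.comp continuous_snd) :
          Continuous fun x : SoftTorus ε × SoftTorus ε ↦
            Completion.map star x.1 + Completion.map star x.2)
    | ih a b =>
      have h := map_coe Pre.uniformContinuous_star (a + b)
      rw [coe_add, star_add, coe_add] at h
      rw [h, map_coe Pre.uniformContinuous_star, map_coe Pre.uniformContinuous_star]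
  star_mul a b := by
    induction a, b using Completion.induction_on₂ with
    | hp =>
      exact isClosed_eq (continuous_map.comp continuous_mul)
        (Continuous.mul (continuous_map.comp continuous_snd) (continuous_map.comp continuous_fst) :
          Continuous fun x : SoftTorus ε × SoftTorus ε ↦
            Completion.map star x.2 * Completion.map star x.1)
    | ih a b =>
      have h := map_coe Pre.uniformContinuous_star (a * b)
      rw [coe_mul, star_mul, coe_mul] at h
      rw [h, map_coe Pre.uniformContinuous_star, map_coe Pre.uniformContinuous_star]

theorem continuous_star' : Continuous (star : SoftTorus ε → SoftTorus ε) := continuous_map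

theorem coe_star (a : Pre ε) : ((star a : Pre ε) : SoftTorus ε) = star (a : SoftTorus ε) :=
  (map_coe Pre.uniformContinuous_star a).symm

instance : NormedAlgebra ℂ (SoftTorus ε) where
  norm_smul_le := norm_smul_le

instance : StarModule ℂ (SoftTorus ε) where
  star_smul r a := by
    induction a using Completion.induction_on with
    | hp =>
      exact isClosed_eq (continuous_star'.comp (continuous_const_smul r))
        (continuous_star'.const_smul (star r))
    | ih a => rw [← coe_smul, ← coe_star, star_smul, coe_smul, coe_star]

instance : CStarRing (SoftTorus ε) where
  norm_mul_self_le a := by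
    induction a using Completion.induction_on with
    | hp =>
      exact isClosed_le (continuous_norm.mul continuous_norm)
        (continuous_norm.comp (continuous_star'.mul continuous_id))
    | ih a =>
      rw [← coe_star, ← coe_mul, norm_coe, norm_coe]
      exact Pre.norm_mul_self_le a

instance : CStarAlgebra (SoftTorus ε) where

/-- The canonical map `ℂ[F₂] → C(𝕋²)_ε`. -/
def ofFree (ε : ℝ) : FreeStarAlg →⋆ₐ[ℂ] SoftTorus ε where
  toFun a := ((show Pre ε from a : Pre ε) : SoftTorus ε)
  map_one' := coe_one (Pre ε)
  map_mul' := coe_mul (α := Pre ε)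
  map_zero' := coe_zero (α := Pre ε)
  map_add' := coe_add (α := Pre ε)
  commutes' _ := rfl
  map_star' := coe_star (ε := ε)

theorem norm_ofFree (a : FreeStarAlg) : ‖ofFree ε a‖ = univNorm ε a :=
  norm_coe (E := Pre ε) a

theorem denseRange_ofFree : DenseRange (ofFree ε) := denseRange_coe (α := Pre ε)

/-- The canonical generators of the soft torus: `u = gen ε 0` and `v = gen ε 1`. -/
def gen (ε : ℝ) (i : Fin 2) : SoftTorus ε := ofFree ε (FreeStarAlg.gen i)

theorem gen_mem_unitary (ε : ℝ) (i : Fin 2) : gen ε i ∈ unitary (SoftTorus ε) := by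
  rw [Unitary.mem_iff, gen, ← map_star, ← map_mul, ← map_mul]
  simp [FreeStarAlg.gen, star_single, single_mul_single, ← FreeStarAlg.one_def]

theorem norm_commutator_gen_le (hε : 0 ≤ ε) :
    ‖gen ε 0 * gen ε 1 - gen ε 1 * gen ε 0‖ ≤ ε := by
  rw [gen, gen, ← map_mul, ← map_mul, ← map_sub, norm_ofFree]
  exact univNorm_le hε fun p hp ↦ hp.comm_le

section Universal

variable {B : Type*} [CStarAlgebra B]

/-- The algebra homomorphism `ℂ[F₂] → B` determined by two unitaries. -/
def freeLiftAlg (W : Fin 2 → unitary B) : FreeStarAlg →ₐ[ℂ] B :=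
  (MonoidAlgebra.lift ℂ B (FreeGroup (Fin 2))
    ((unitary B).subtype.comp (FreeGroup.lift W)) : MonoidAlgebra ℂ (FreeGroup (Fin 2)) →ₐ[ℂ] B)

theorem freeLiftAlg_single (W : Fin 2 → unitary B) (g : FreeGroup (Fin 2)) (c : ℂ) :
    freeLiftAlg W (single g c) = c • (FreeGroup.lift W g : B) :=
  MonoidAlgebra.lift_single _ _ _

/-- The `*`-homomorphism `ℂ[F₂] → B` determined by two unitaries. -/
def freeLift (W : Fin 2 → unitary B) : FreeStarAlg →⋆ₐ[ℂ] B where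
  __ := freeLiftAlg W
  map_star' a := by
    change freeLiftAlg W (star a) = star (freeLiftAlg W a)
    induction a using FreeStarAlg.induction with
    | hadd x y hx hy => rw [star_add, map_add, map_add, hx, hy, star_add]
    | hsingle g c =>
      rw [star_single, freeLiftAlg_single, freeLiftAlg_single, star_smul, map_inv]
      rfl

theorem freeLift_single (W : Fin 2 → unitary B) (g : FreeGroup (Fin 2)) (c : ℂ) :
    freeLift W (single g c) = c • (FreeGroup.lift W g : B) :=
  freeLiftAlg_single W g c

theorem freeLift_gen (W : Fin 2 → unitary B) (i : Fin 2) :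
    freeLift W (FreeStarAlg.gen i) = W i := by
  simp [FreeStarAlg.gen, freeLift_single]

theorem norm_freeLift_le (W : Fin 2 → unitary B)
    (hW : ‖(W 0 * W 1 - W 1 * W 0 : B)‖ ≤ ε) (a : FreeStarAlg) :
    ‖freeLift W a‖ ≤ univNorm ε a := by
  have hp : IsAdmissible ε
      ((normSeminorm ℂ B).comp (freeLift W).toAlgHom.toLinearMap) := by
    refine ⟨fun a b ↦ ?_, fun a ↦ ?_, ?_⟩
    · change ‖freeLift W (a * b)‖ ≤ ‖freeLift W a‖ * ‖freeLift W b‖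
      rw [map_mul]
      exact norm_mul_le _ _
    · change ‖freeLift W (star a * a)‖ = ‖freeLift W a‖ ^ 2
      rw [map_mul, map_star, CStarRing.norm_star_mul_self, sq]
    · change ‖freeLift W _‖ ≤ ε
      rwa [map_sub, map_mul, map_mul, freeLift_gen, freeLift_gen]
  exact le_univNorm hp a

/-- `freeLift W`, as a ring homomorphism on the seminormed ring `Pre ε`. -/
def preLift (ε : ℝ) (W : Fin 2 → unitary B) : Pre ε →+* B := (freeLift W).toAlgHom.toRingHom

theorem continuous_preLift (W : Fin 2 → unitary B)
    (hW : ‖(W 0 * W 1 - W 1 * W 0 : B)‖ ≤ ε) : Continuous (preLift ε W) :=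
  AddMonoidHomClass.continuous_of_bound (preLift ε W) 1
    fun a ↦ by rw [one_mul]; exact norm_freeLift_le W hW a

/-- The `*`-homomorphism from the soft torus determined by two unitaries `W 0`, `W 1` commuting up
to `ε`. -/
def lift (W : Fin 2 → unitary B) (hW : ‖(W 0 * W 1 - W 1 * W 0 : B)‖ ≤ ε) :
    SoftTorus ε →⋆ₐ[ℂ] B :=
  { Completion.extensionHom (preLift ε W) (continuous_preLift W hW) with
    commutes' := fun r ↦
      (Completion.extensionHom_coe (preLift ε W) (continuous_preLift W hW) (algebraMap ℂ (Pre ε) r)).trans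
        ((freeLift W).toAlgHom.commutes r)
    map_star' := fun a ↦ by
      change Completion.extensionHom (preLift ε W) (continuous_preLift W hW) (star a) =
        star (Completion.extensionHom (preLift ε W) (continuous_preLift W hW) a)
      induction a using Completion.induction_on with
      | hp =>
        exact isClosed_eq (Completion.continuous_extension.comp continuous_star')
          (continuous_star.comp Completion.continuous_extension)
      | ih a =>
        rw [← coe_star, Completion.extensionHom_coe, Completion.extensionHom_coe]
        exact map_star (freeLift W) a }

theorem lift_ofFree (W : Fin 2 → unitary B) (hW : ‖(W 0 * W 1 - W 1 * W 0 : B)‖ ≤ ε)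
    (a : FreeStarAlg) : lift W hW (ofFree ε a) = freeLift W a :=
  Completion.extensionHom_coe (α := Pre ε) (preLift ε W) (continuous_preLift W hW) a

theorem lift_gen (W : Fin 2 → unitary B) (hW : ‖(W 0 * W 1 - W 1 * W 0 : B)‖ ≤ ε)
    (i : Fin 2) : lift W hW (gen ε i) = W i := by
  rw [gen, lift_ofFree, freeLift_gen]

theorem continuous_hom (φ : SoftTorus ε →⋆ₐ[ℂ] B) : Continuous φ :=
  AddMonoidHomClass.continuous_of_bound φ 1 fun a ↦ by
    rw [one_mul]; exact NonUnitalStarAlgHom.norm_apply_le φ a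

theorem hom_ext {φ ψ : SoftTorus ε →⋆ₐ[ℂ] B} (h : ∀ i, φ (gen ε i) = ψ (gen ε i)) : φ = ψ := by
  have hsingle : ∀ g : FreeGroup (Fin 2), φ (ofFree ε (single g 1)) = ψ (ofFree ε (single g 1)) := by
    intro g
    induction g using FreeGroup.induction_on with
    | C1 => rw [← FreeStarAlg.one_def]; simp
    | of i => exact h i
    | inv_of i hi =>
      have : single (FreeGroup.of i)⁻¹ 1 = star (single (FreeGroup.of i) 1) := by
        rw [star_single, map_one]
      rw [this, map_star, map_star, map_star, hi]
    | mul x y hx hy =>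
      have : single (x * y) 1 = single x 1 * single y 1 := by
        rw [single_mul_single, mul_one]
      rw [this, map_mul, map_mul, map_mul, hx, hy]
  have hfree : ∀ a : FreeStarAlg, φ (ofFree ε a) = ψ (ofFree ε a) := by
    intro a
    induction a using FreeStarAlg.induction with
    | hadd x y hx hy => rw [map_add, map_add, map_add, hx, hy]
    | hsingle g c =>
      have : single g c = c • single g 1 := by rw [smul_single, mul_one]
      rw [this, map_smul, map_smul, map_smul, hsingle g]
  exact DFunLike.coe_injective <| denseRange_ofFree.equalizer
    (continuous_hom φ) (continuous_hom ψ) (funext hfree)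

/-- The universal property of the soft torus: for every pair of unitaries `W 0`, `W 1` of a unital
C⋆-algebra with `‖[W 0, W 1]‖ ≤ ε`, there is a unique unital `*`-homomorphism mapping `u` to `W 0`
and `v` to `W 1`. -/
theorem existsUnique_hom (W : Fin 2 → unitary B)
    (hW : ‖(W 0 * W 1 - W 1 * W 0 : B)‖ ≤ ε) :
    ∃! φ : SoftTorus ε →⋆ₐ[ℂ] B, ∀ i, φ (gen ε i) = W i :=
  ⟨lift W hW, lift_gen W hW, fun _ hψ ↦ hom_ext fun i ↦ (hψ i).trans (lift_gen W hW i).symm⟩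

end Universal

end SoftTorus

/-- A C⋆-algebra is residually finite-dimensional if it has a separating family of
finite-dimensional representations, i.e. of `*`-homomorphisms into matrix algebras `M_n(ℂ)`:
every nonzero element is mapped to a nonzero matrix by one of them. -/
def IsRFD (A : Type*) [NonUnitalCStarAlgebra A] : Prop :=
  ∀ a : A, a ≠ 0 → ∃ (n : ℕ) (π : A →⋆ₙₐ[ℂ] Matrix (Fin n) (Fin n) ℂ), π a ≠ 0

end

/-! A nonzero element is seen by a vector `η` in some Hilbert space representation, so it is enough
to approximate, on one vector, a pair of unitaries `u`, `v` on `H` with `‖uv - vu‖ ≤ ε` by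
finite-dimensional pairs satisfying the same bound with the same `ε`. The conjugates `u_n = v⁻ⁿ u
vⁿ` form a path of unitaries with steps of size at most `ε`. The path can be copied on a
finite-dimensional `L`, without enlarging the steps and exactly on prescribed vectors
(`exists_finiteDimensional_chain`): the Cayley transform turns a unitary near `1` into a
skew-adjoint operator, and these can be compressed to `L`. On a direct sum of copies of `L`, let `U`
be diagonal, running along the path and back again, and let `V` be the cyclic shift. Neighbouring
entries of `U` differ by at most `ε`, including across the cyclic seam, so `‖UV - VU‖ ≤ ε`. The
vector with entries `v⁻ʲ η` for `j ≤ N` imitates `η`: a polynomial `b` in `U`, `V` and their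
inverses produces `v⁻ʲ b(u, v) η` in all coordinates away from the ends. Comparing norms bounds
`‖b(u, v) η‖` by `2 ‖b(U, V)‖ ‖η‖`. The constant does not depend on `b`, so a density argument
passes from the free `*`-algebra to the soft torus. -/

noncomputable section

open scoped InnerProductSpace ComplexOrder

/-! ### Positive functionals and the GNS representation -/

/-- A nonzero element of a unital C⋆-algebra is detected by a positive linear functional. -/
theorem CStarAlgebra.exists_positiveLinearMap_star_mul_self_ne_zero {A : Type*} [CStarAlgebra A]
    [PartialOrder A] [StarOrderedRing A] {a : A} (ha : a ≠ 0) :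
    ∃ f : A →ₚ[ℂ] ℂ, f (star a * a) ≠ 0 := by
  let C : ProperCone ℝ A := ProperCone.positive ℝ A
  have hmem : -(star a * a) ∉ C := fun h ↦ by
    have h0 : 0 ≤ -(star a * a) := h
    have h1 : star a * a = 0 := le_antisymm (neg_nonneg.mp h0) (star_mul_self_nonneg a)
    exact ha (CStarRing.star_mul_self_eq_zero_iff a |>.mp h1)
  obtain ⟨f, hf, hfa⟩ := C.hyperplane_separation_point hmem
  -- The separating functional is only real linear. Precomposing with the real part and
  -- complexifying leaves its values on positive elements unchanged.
  let g : Module.Dual ℝ A := f.toLinearMap ∘ₗ (selfAdjoint.submodule ℝ A).subtype ∘ₗ realPart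
  have hg : ∀ x, 0 ≤ x → (g.extendRCLike x : ℂ) = (f x : ℂ) := fun x hx ↦ by
    have hsa : IsSelfAdjoint x := .of_nonneg hx
    have h1 : g x = f x := congrArg f hsa.coe_realPart
    have h2 : g (Complex.I • x) = 0 := by
      change f (realPart (Complex.I • x) : A) = 0
      rw [realPart_I_smul, hsa.imaginaryPart]
      simp
    rw [Module.Dual.extendRCLike_apply]
    simp [h1, h2]
  refine ⟨PositiveLinearMap.mk₀ g.extendRCLike fun x hx ↦ ?_, ?_⟩
  · rw [hg x hx]
    exact_mod_cast hf x hx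
  · change (g.extendRCLike (star a * a) : ℂ) ≠ 0
    rw [hg _ (star_mul_self_nonneg a)]
    rw [map_neg] at hfa
    exact_mod_cast (by linarith : f (star a * a) ≠ 0)

/-- A nonzero element of a unital C⋆-algebra is detected by a vector of some Hilbert space
representation. -/
theorem CStarAlgebra.exists_representation_apply_ne_zero.{u} {A : Type u} [CStarAlgebra A] {a : A}
    (ha : a ≠ 0) : ∃ (H : Type u) (_ : NormedAddCommGroup H) (_ : InnerProductSpace ℂ H)
      (_ : CompleteSpace H) (π : A →⋆ₐ[ℂ] (H →L[ℂ] H)) (x : H), π a x ≠ 0 := by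
  let _ := CStarAlgebra.spectralOrder A
  let _ := CStarAlgebra.spectralOrderedRing A
  obtain ⟨f, hf⟩ := CStarAlgebra.exists_positiveLinearMap_star_mul_self_ne_zero ha
  -- The class of `1` has `‖π(a) 1‖² = f (a⋆ a)`.
  refine ⟨f.GNS, inferInstance, inferInstance, inferInstance, f.gnsStarAlgHom,
    ((f.toPreGNS 1 : f.PreGNS) : f.GNS), fun h ↦ hf ?_⟩
  change f.gnsNonUnitalStarAlgHom a ((f.toPreGNS 1 : f.PreGNS) : f.GNS) = 0 at h
  rw [PositiveLinearMap.gnsNonUnitalStarAlgHom_apply_coe, ← norm_eq_zero, UniformSpace.Completion.norm_coe] at h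
  have h2 := f.preGNS_norm_sq (f.leftMulMapPreGNS a (f.toPreGNS 1))
  rw [h] at h2
  simpa using h2.symm

/-! ### Cayley transform and compression of unitaries -/

section Extension

variable {H : Type*} [NormedAddCommGroup H] [InnerProductSpace ℂ H]

/-- The Cayley transform of a skew-adjoint operator on a finite-dimensional space is unitary. -/
theorem exists_linearIsometryEquiv_cayley [FiniteDimensional ℂ H] (s : H →ₗ[ℂ] H)
    (hs : ∀ x, (⟪s x, x⟫_ℂ).re = 0) :
    ∃ w : H ≃ₗᵢ[ℂ] H, (∀ x, w (x - s x) = x + s x) ∧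
      ∀ y, ∃ x, y = x - s x ∧ ‖y‖ ^ 2 = ‖x‖ ^ 2 + ‖s x‖ ^ 2 := by
  -- Skewness kills the cross term, so `1 - s` and `1 + s` stretch every vector equally; thus `(1 +
  -- s)(1 - s)⁻¹` is isometric.
  have hsub : ∀ x, ‖x - s x‖ ^ 2 = ‖x‖ ^ 2 + ‖s x‖ ^ 2 := fun x ↦ by
    have h := norm_sub_sq (𝕜 := ℂ) x (s x)
    rw [← inner_conj_symm, RCLike.conj_re] at h
    rw [h, RCLike.re_eq_complex_re, hs]
    ring
  have hadd : ∀ x, ‖x + s x‖ ^ 2 = ‖x‖ ^ 2 + ‖s x‖ ^ 2 := fun x ↦ by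
    have h := norm_add_sq (𝕜 := ℂ) x (s x)
    rw [← inner_conj_symm, RCLike.conj_re] at h
    rw [h, RCLike.re_eq_complex_re, hs]
    ring
  have hinj : Function.Injective (LinearMap.id - s : H →ₗ[ℂ] H) := by
    rw [injective_iff_map_eq_zero]
    intro x hx
    have h := hsub x
    change x - s x = 0 at hx
    rw [hx, norm_zero] at h
    have : ‖x‖ ^ 2 = 0 := by nlinarith [sq_nonneg ‖x‖, sq_nonneg ‖s x‖]
    simpa using this
  let e : H ≃ₗ[ℂ] H := LinearEquiv.ofInjectiveEndo _ hinj
  have he : ∀ x, e.symm (x - s x) = x := fun x ↦ e.symm_apply_apply x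
  let w : H →ₗᵢ[ℂ] H :=
    { toLinearMap := ((LinearMap.id + s : H →ₗ[ℂ] H) ∘ₗ (e.symm : H →ₗ[ℂ] H) : H →ₗ[ℂ] H)
      norm_map' := fun y ↦ by
        obtain ⟨x, rfl⟩ := e.surjective y
        change ‖e.symm (e x) + s (e.symm (e x))‖ = ‖x - s x‖
        rw [e.symm_apply_apply, ← sq_eq_sq₀ (norm_nonneg _) (norm_nonneg _), hsub, hadd] }
  refine ⟨w.toLinearIsometryEquiv rfl, fun x ↦ ?_, fun y ↦
    ⟨e.symm y, (e.apply_symm_apply y).symm, ?_⟩⟩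
  swap
  · rw [← hsub]
    exact congrArg (‖·‖ ^ 2) (e.apply_symm_apply y).symm
  change e.symm (x - s x) + s (e.symm (x - s x)) = _
  rw [he]

/-- The inverse Cayley transform of a unitary at distance less than `2` from the identity. -/
theorem exists_skew_of_norm_sub_le [CompleteSpace H] {ε : ℝ} (hε : 0 ≤ ε) (hε2 : ε < 2)
    (w : H ≃ₗᵢ[ℂ] H) (hw : ∀ x, ‖w x - x‖ ≤ ε * ‖x‖) :
    ∃ s : H →ₗ[ℂ] H, (∀ x, s (w x + x) = w x - x) ∧ (∀ x, (⟪s x, x⟫_ℂ).re = 0) ∧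
      ∀ x, 4 * ‖s x‖ ^ 2 ≤ ε ^ 2 * (‖s x‖ ^ 2 + ‖x‖ ^ 2) := by
  let W : H →L[ℂ] H := w.toContinuousLinearEquiv.toContinuousLinearMap
  -- As `ε < 2`, a Neumann series inverts `T = (1 + W)/2`; then `s = (W - 1)(W + 1)⁻¹`.
  have hnorm : ‖(2⁻¹ : ℂ) • (1 - W)‖ < 1 := by
    refine lt_of_le_of_lt (ContinuousLinearMap.opNorm_le_bound _ (by positivity : 0 ≤ ε / 2)
      fun x ↦ ?_) (by linarith)
    change ‖(2⁻¹ : ℂ) • (x - w x)‖ ≤ _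
    rw [norm_smul, norm_sub_rev]
    norm_num
    linarith [hw x]
  have hunit := isUnit_one_sub_of_norm_lt_one hnorm
  have hsum : (1 : H →L[ℂ] H) - (2⁻¹ : ℂ) • (1 - W) = (2⁻¹ : ℂ) • (1 + W) := by
    module
  rw [hsum] at hunit
  obtain ⟨T, hT⟩ := hunit
  have hl : ∀ x, (T⁻¹ : (H →L[ℂ] H)ˣ).1 (w x + x) = (2 : ℂ) • x := fun x ↦ by
    have h := congrArg (fun S : H →L[ℂ] H ↦ S x) T.inv_mul
    rw [hT] at h
    change T.inv ((2⁻¹ : ℂ) • (x + w x)) = x at h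
    rw [map_smul, inv_smul_eq_iff₀ two_ne_zero, add_comm] at h
    exact h
  have hsurj : ∀ y, ∃ x, y = w x + x := fun y ↦ by
    refine ⟨(2⁻¹ : ℂ) • T⁻¹.1 y, ?_⟩
    have h := congrArg (fun S : H →L[ℂ] H ↦ S y) T.mul_inv
    rw [hT] at h
    change (2⁻¹ : ℂ) • (T⁻¹.1 y + w (T⁻¹.1 y)) = y at h
    rw [map_smul, ← smul_add, add_comm, h]
  let s : H →ₗ[ℂ] H := (2⁻¹ : ℂ) • (W - 1).toLinearMap ∘ₗ (T⁻¹.1).toLinearMap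
  have hs : ∀ x, s (w x + x) = w x - x := fun x ↦ by
    change (2⁻¹ : ℂ) • (w (T⁻¹.1 (w x + x)) - T⁻¹.1 (w x + x)) = _
    rw [hl, map_smul, ← smul_sub, inv_smul_smul₀ two_ne_zero]
  refine ⟨s, hs, fun y ↦ ?_, fun y ↦ ?_⟩
  · obtain ⟨x, rfl⟩ := hsurj y
    rw [hs, inner_sub_left, inner_add_right, inner_add_right, w.inner_map_map,
      ← inner_conj_symm x (w x)]
    simp only [Complex.add_re, Complex.sub_re, Complex.conj_re]
    ring
  · obtain ⟨x, rfl⟩ := hsurj y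
    rw [hs]
    -- For `y = w x + x` this reads `‖y‖² + ‖s y‖² = 4‖x‖²`, which turns the distance bound into one
    -- on `s`.
    have h := parallelogram_law_with_norm ℂ (w x) x
    rw [w.norm_map] at h
    have h2 := pow_le_pow_left₀ (norm_nonneg _) (hw x) 2
    nlinarith

/-- A unitary on a Hilbert space agrees on any finite-dimensional subspace with a unitary on a
finite-dimensional space, which can be chosen to be at least as close to the identity. -/
theorem exists_linearIsometryEquiv_eqOn [CompleteSpace H] {ε : ℝ} (hε : 0 ≤ ε)
    (w : H ≃ₗᵢ[ℂ] H) (hw : ∀ x, ‖w x - x‖ ≤ ε * ‖x‖) (K L : Submodule ℂ H) [FiniteDimensional ℂ L]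
    (hKL : K ≤ L) (hwK : ∀ x ∈ K, w x ∈ L) :
    ∃ w' : L ≃ₗᵢ[ℂ] L, (∀ x, ‖w' x - x‖ ≤ ε * ‖x‖) ∧
      ∀ (x : H) (hx : x ∈ K), (w' ⟨x, hKL hx⟩ : H) = w x := by
  rcases lt_or_ge ε 2 with hε2 | hε2
  · obtain ⟨s, hs, hskew, hbound⟩ := exists_skew_of_norm_sub_le hε hε2 w hw
    -- Compression preserves skewness, whereas compressing `w` itself would lose unitarity.
    let s' : L →ₗ[ℂ] L := L.orthogonalProjectionOnto.toLinearMap ∘ₗ s ∘ₗ L.subtype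
    have hs' : ∀ x : L, s' x = L.orthogonalProjectionOnto (s x) := fun _ ↦ rfl
    obtain ⟨w', hw', hnorm⟩ := exists_linearIsometryEquiv_cayley s' fun x ↦ by
      rw [hs', Submodule.inner_orthogonalProjectionOnto_eq_of_mem_right, hskew]
    refine ⟨w', fun y ↦ ?_, fun x hx ↦ ?_⟩
    · obtain ⟨x, rfl, hy⟩ := hnorm y
      have h1 : w' (x - s' x) - (x - s' x) = (2 : ℂ) • s' x := by
        rw [hw', two_smul]
        abel
      have h2 : ‖s' x‖ ≤ ‖s x‖ := L.norm_orthogonalProjectionOnto_apply_le _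
      have h3 := hbound x
      have h4 := pow_le_pow_left₀ (norm_nonneg _) h2 2
      rw [h1, norm_smul, ← sq_le_sq₀ (by positivity) (by positivity), mul_pow, mul_pow, hy]
      rw [← Submodule.coe_norm] at h3
      rw [Complex.norm_two]
      -- Since `ε < 2`, `(4 - ε²)‖s' x‖² ≤ (4 - ε²)‖s x‖² ≤ ε²‖x‖²`.
      nlinarith [mul_le_mul_of_nonneg_left h4 (by nlinarith : 0 ≤ 4 - ε ^ 2)]
    -- For `x ∈ K`, `s` maps `w x + x ∈ L` to `w x - x ∈ L`, so the projection changes nothing there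
    -- and the Cayley transform returns `w x`.
    · have hsum : w x + x ∈ L := L.add_mem (hwK x hx) (hKL hx)
      have hdiff : w x - x ∈ L := L.sub_mem (hwK x hx) (hKL hx)
      have h1 : s' ⟨w x + x, hsum⟩ = ⟨w x - x, hdiff⟩ := by
        rw [hs', hs]
        exact L.orthogonalProjectionOnto_mem_subspace_eq_self ⟨w x - x, hdiff⟩
      have h2 := hw' ⟨w x + x, hsum⟩
      have h3 : (⟨w x + x, hsum⟩ : L) - ⟨w x - x, hdiff⟩ = (2 : ℂ) • ⟨x, hKL hx⟩ := by
        ext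
        simp [two_smul]
      rw [h1, h3, map_smul] at h2
      have h4 := congrArg (Subtype.val : L → H) h2
      have h5 : (2 : ℂ) • (w' ⟨x, hKL hx⟩ : H) = (2 : ℂ) • w x := by
        refine h4.trans ?_
        simp [two_smul]
      exact smul_right_injective H two_ne_zero h5
  -- For `ε ≥ 2` any two unitaries satisfy the distance bound, so any isometric extension works.
  · have hfin : ∀ x : K.comap L.subtype, w (x : L) ∈ L := fun x ↦ hwK _ x.2
    let f : K.comap L.subtype →ₗᵢ[ℂ] L :=
      { toLinearMap := LinearMap.codRestrict L
          (w.toLinearEquiv.toLinearMap ∘ₗ L.subtype ∘ₗ (K.comap L.subtype).subtype) hfin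
        norm_map' := fun x ↦ w.norm_map _ }
    refine ⟨f.extend.toLinearIsometryEquiv rfl, fun x ↦ ?_, fun x hx ↦ ?_⟩
    · refine (norm_sub_le _ _).trans ?_
      rw [LinearIsometryEquiv.norm_map]
      nlinarith [norm_nonneg x]
    · exact congrArg Subtype.val (f.extend_apply ⟨⟨x, hKL hx⟩, hx⟩)

end Extension

/-! ### Finite-dimensional copies of paths of unitaries -/

section Chain

variable {H : Type*} [NormedAddCommGroup H] [InnerProductSpace ℂ H] [CompleteSpace H]

/-- A finite sequence of unitaries with consecutive distances at most `ε` agrees on any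
finite-dimensional subspace with such a sequence of unitaries on all large enough
finite-dimensional subspaces. -/
theorem exists_finiteDimensional_chain {ε : ℝ} (hε : 0 ≤ ε) (u : ℕ → H ≃ₗᵢ[ℂ] H)
    (hu : ∀ n x, ‖u (n + 1) x - u n x‖ ≤ ε * ‖x‖) (K : Submodule ℂ H) [FiniteDimensional ℂ K]
    (N : ℕ) : ∃ L₀ : Submodule ℂ H, FiniteDimensional ℂ L₀ ∧ K ≤ L₀ ∧
      ∀ L : Submodule ℂ H, FiniteDimensional ℂ L → L₀ ≤ L → ∃ u' : ℕ → L ≃ₗᵢ[ℂ] L,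
        (∀ n x, ‖u' (n + 1) x - u' n x‖ ≤ ε * ‖x‖) ∧
        ∀ n ≤ N, ∀ x ∈ K, ∃ hx : x ∈ L, (u' n ⟨x, hx⟩ : H) = u n x := by
  have hmem : ∀ n, ∀ x ∈ K, u n x ∈ K.map (u n).toLinearEquiv.toLinearMap :=
    fun n x hx ↦ ⟨x, hx, rfl⟩
  induction N with
  | zero =>
    refine ⟨K ⊔ K.map (u 0).toLinearEquiv.toLinearMap, inferInstance, le_sup_left,
      fun L _ hL ↦ ?_⟩
    obtain ⟨w, -, hw⟩ := exists_linearIsometryEquiv_eqOn zero_le_two (u 0)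
      (fun x ↦ by
        have h := norm_sub_le (u 0 x) x
        rw [LinearIsometryEquiv.norm_map] at h
        linarith) K L (le_sup_left.trans hL)
      fun x hx ↦ hL (Submodule.mem_sup_right (hmem 0 x hx))
    refine ⟨fun _ ↦ w, fun n x ↦ by simpa using by positivity, fun n hn x hx ↦ ?_⟩
    obtain rfl : n = 0 := by lia
    exact ⟨_, hw x hx⟩
  | succ N ih =>
    obtain ⟨L₀, hL₀, hK, h⟩ := ih
    refine ⟨L₀ ⊔ (K.map (u N).toLinearEquiv.toLinearMap ⊔
      K.map (u (N + 1)).toLinearEquiv.toLinearMap), inferInstance, hK.trans le_sup_left,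
      fun L _ hL ↦ ?_⟩
    obtain ⟨u', hstep, hu'⟩ := h L inferInstance (le_sup_left.trans hL)
    -- Only the increment `u_{N+1} u_N⁻¹`, which is `ε`-close to `1`, is copied, on `u_N K`; the
    -- next unitary is `w ∘ u'_N`, and the sequence is constant afterwards.
    obtain ⟨w, hw1, hw⟩ := exists_linearIsometryEquiv_eqOn hε ((u N).symm.trans (u (N + 1)))
      (fun x ↦ by
        have h := hu N ((u N).symm x)
        rwa [LinearIsometryEquiv.apply_symm_apply, LinearIsometryEquiv.norm_map] at h)
      (K.map (u N).toLinearEquiv.toLinearMap) L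
      ((le_sup_left.trans le_sup_right).trans hL) (by
        rintro _ ⟨x, hx, rfl⟩
        refine hL (Submodule.mem_sup_right (Submodule.mem_sup_right ?_))
        convert hmem (N + 1) x hx using 1
        exact congrArg (u (N + 1)) ((u N).symm_apply_apply x))
    refine ⟨fun n ↦ if n ≤ N then u' n else (u' N).trans w, fun n x ↦ ?_, fun n hn x hx ↦ ?_⟩
    · rcases lt_trichotomy n N with hn | rfl | hn
      · simpa [hn.le, Nat.succ_le_of_lt hn] using hstep n x
      · simpa using hw1 (u' n x)
      · have h1 : ¬ n ≤ N := by lia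
        have h2 : ¬ n + 1 ≤ N := by lia
        simpa [h1, h2] using by positivity
    · rcases Nat.lt_or_ge N n with hn' | hn'
      · obtain rfl : n = N + 1 := by lia
        obtain ⟨hxL, hx2⟩ := hu' N le_rfl x hx
        refine ⟨hxL, ?_⟩
        have h1 := hw (u N x) (hmem N x hx)
        have h2 : u' N ⟨x, hxL⟩ = ⟨u N x, hx2 ▸ (u' N ⟨x, hxL⟩).2⟩ := Subtype.ext hx2
        simp only [Nat.not_succ_le_self, if_false]
        change (w (u' N ⟨x, hxL⟩) : H) = _
        rw [h2]
        refine h1.trans ?_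
        exact congrArg (u (N + 1)) ((u N).symm_apply_apply x)
      · simpa [hn'] using hu' n hn' x hx

end Chain

namespace SoftTorus

/-! ### The block diagonal and cyclic shift model -/

section Model

variable {L : Type*} [NormedAddCommGroup L] [InnerProductSpace ℂ L]

/-- The palindromic sequence `0, 1, …, N, N, …, 1, 0`. -/
def fold (N : ℕ) (j : Fin (2 * N + 2)) : ℕ := min j (2 * N + 1 - j)

theorem fold_of_le {N : ℕ} {j : Fin (2 * N + 2)} (hj : (j : ℕ) ≤ N) : fold N j = j := by
  unfold fold; lia

theorem coe_finRotate_eq {N : ℕ} {j : Fin (2 * N + 2)} (hj : (j : ℕ) ≤ N) :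
    (finRotate (2 * N + 2) j : ℕ) = j + 1 :=
  coe_finRotate_of_ne_last fun h ↦ by
    have := congrArg Fin.val h
    rw [Fin.val_last] at this
    lia

theorem coe_finRotate_symm_eq {N : ℕ} {j : Fin (2 * N + 2)} (hj : 1 ≤ (j : ℕ)) :
    ((finRotate (2 * N + 2)).symm j : ℕ) = j - 1 :=
  coe_finRotate_symm_of_ne_zero fun h ↦ by simp [h] at hj

/-- The repeated `N` in the middle and the two zeros meeting at the cyclic seam make neighbours
differ by at most one. -/
theorem fold_finRotate (N : ℕ) (j : Fin (2 * N + 2)) :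
    fold N (finRotate _ j) = fold N j ∨ fold N (finRotate _ j) = fold N j + 1 ∨
      fold N j = fold N (finRotate _ j) + 1 := by
  unfold fold
  rcases eq_or_ne j (Fin.last _) with rfl | hj
  · rw [finRotate_last]
    simp
  · rw [coe_finRotate_of_ne_last hj]
    have := j.2
    lia

/-- The block diagonal unitary with entries `u' 0, …, u' N, u' N, …, u' 0`. -/
def blockDiag (N : ℕ) (u' : ℕ → L ≃ₗᵢ[ℂ] L) :
    PiLp 2 (fun _ : Fin (2 * N + 2) ↦ L) ≃ₗᵢ[ℂ] PiLp 2 (fun _ : Fin (2 * N + 2) ↦ L) :=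
  LinearIsometryEquiv.piLpCongrRight 2 fun j ↦ u' (fold N j)

/-- The cyclic shift. -/
def blockShift (N : ℕ) (L : Type*) [NormedAddCommGroup L] [InnerProductSpace ℂ L] :
    PiLp 2 (fun _ : Fin (2 * N + 2) ↦ L) ≃ₗᵢ[ℂ] PiLp 2 (fun _ : Fin (2 * N + 2) ↦ L) :=
  LinearIsometryEquiv.piLpCongrLeft 2 ℂ L (finRotate _)

theorem blockDiag_apply (N : ℕ) (u' : ℕ → L ≃ₗᵢ[ℂ] L) (x : PiLp 2 (fun _ : Fin (2 * N + 2) ↦ L))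
    (j : Fin (2 * N + 2)) : blockDiag N u' x j = u' (fold N j) (x j) := rfl

theorem blockDiag_inv_apply (N : ℕ) (u' : ℕ → L ≃ₗᵢ[ℂ] L)
    (x : PiLp 2 (fun _ : Fin (2 * N + 2) ↦ L)) (j : Fin (2 * N + 2)) :
    (blockDiag N u')⁻¹ x j = (u' (fold N j)).symm (x j) := rfl

theorem blockShift_apply (N : ℕ) (x : PiLp 2 (fun _ : Fin (2 * N + 2) ↦ L))
    (j : Fin (2 * N + 2)) : blockShift N L x j = x ((finRotate _).symm j) := rfl

theorem blockShift_inv_apply (N : ℕ) (x : PiLp 2 (fun _ : Fin (2 * N + 2) ↦ L))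
    (j : Fin (2 * N + 2)) : (blockShift N L)⁻¹ x j = x (finRotate _ j) := by
  change (blockShift N L).symm x j = _
  rw [blockShift, LinearIsometryEquiv.piLpCongrLeft_symm]
  rfl

/-- The coordinate of the commutator after `j` in cyclic order is the difference of two neighbouring
diagonal entries applied to `x j`. -/
theorem norm_blockDiag_blockShift_sub_le {ε : ℝ} (hε : 0 ≤ ε) (N : ℕ) (u' : ℕ → L ≃ₗᵢ[ℂ] L)
    (hu' : ∀ n x, ‖u' (n + 1) x - u' n x‖ ≤ ε * ‖x‖)
    (x : PiLp 2 (fun _ : Fin (2 * N + 2) ↦ L)) :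
    ‖blockDiag N u' (blockShift N L x) - blockShift N L (blockDiag N u' x)‖ ≤ ε * ‖x‖ := by
  rw [← sq_le_sq₀ (norm_nonneg _) (by positivity), mul_pow, PiLp.norm_sq_eq_of_L2,
    PiLp.norm_sq_eq_of_L2, Finset.mul_sum, ← Equiv.sum_comp (finRotate (2 * N + 2))]
  refine Finset.sum_le_sum fun j _ ↦ ?_
  rw [← mul_pow]
  refine pow_le_pow_left₀ (norm_nonneg _) ?_ 2
  rw [PiLp.sub_apply, blockDiag_apply, blockShift_apply, blockShift_apply, blockDiag_apply,
    Equiv.symm_apply_apply]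
  rcases fold_finRotate N j with h | h | h
  · rw [h, sub_self, norm_zero]
    positivity
  · rw [h]
    exact hu' _ _
  · rw [h, norm_sub_rev]
    exact hu' _ _

end Model

/-! ### Following a vector through words in the model -/

section Tracking

variable {H : Type*} [NormedAddCommGroup H] [InnerProductSpace ℂ H]

/-- The unitaries `u' n` on `L` agree with `v⁻ⁿ u vⁿ` on the vectors `v⁻ⁿ η` for `η ∈ T`, `n ≤ N`. -/
def Agrees (u v : H ≃ₗᵢ[ℂ] H) (N : ℕ) (L : Submodule ℂ H) (u' : ℕ → L ≃ₗᵢ[ℂ] L) (T : Set H) :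
    Prop :=
  ∀ n ≤ N, ∀ η ∈ T, ∃ h : (v ^ n)⁻¹ η ∈ L, (u' n ⟨(v ^ n)⁻¹ η, h⟩ : H) = (v ^ n)⁻¹ (u η)

/-- The coordinates of `Ξ` with indices in `[d, N - d]` are `v⁻ʲ η`. -/
def Tracks (v : H ≃ₗᵢ[ℂ] H) (N : ℕ) (L : Submodule ℂ H) (d : ℕ) (η : H)
    (Ξ : PiLp 2 (fun _ : Fin (2 * N + 2) ↦ L)) : Prop :=
  ∀ j : Fin (2 * N + 2), d ≤ j → j + d ≤ N → (Ξ j : H) = (v ^ (j : ℕ))⁻¹ η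

variable {u v : H ≃ₗᵢ[ℂ] H} {N : ℕ} {L : Submodule ℂ H} {u' : ℕ → L ≃ₗᵢ[ℂ] L} {T : Set H} {d : ℕ}
  {η : H} {Ξ : PiLp 2 (fun _ : Fin (2 * N + 2) ↦ L)}

theorem Agrees.mono (h : Agrees u v N L u' T) {S : Set H} (hS : S ⊆ T) : Agrees u v N L u' S :=
  fun n hn η hη ↦ h n hn η (hS hη)

theorem Tracks.mono (h : Tracks v N L d η Ξ) {e : ℕ} (he : d ≤ e) : Tracks v N L e η Ξ :=
  fun j hj hj' ↦ h j (he.trans hj) (by lia)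

theorem Tracks.add (h : Tracks v N L d η Ξ) {η' : H} {Ξ' : PiLp 2 (fun _ : Fin (2 * N + 2) ↦ L)}
    (h' : Tracks v N L d η' Ξ') : Tracks v N L d (η + η') (Ξ + Ξ') := fun j hj hj' ↦ by
  rw [PiLp.add_apply, Submodule.coe_add, h j hj hj', h' j hj hj', map_add]

theorem Tracks.smul (h : Tracks v N L d η Ξ) (c : ℂ) : Tracks v N L d (c • η) (c • Ξ) :=
  fun j hj hj' ↦ by
    rw [PiLp.smul_apply, Submodule.coe_smul, h j hj hj', map_smul]

/-- On `v⁻ʲ η` the entry `u' j` acts as `v⁻ʲ u vʲ`, giving `v⁻ʲ (u η)`. -/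
theorem Tracks.blockDiag (h : Tracks v N L d η Ξ) (hT : Agrees u v N L u' {η}) :
    Tracks v N L d (u η) (blockDiag N u' Ξ) := fun j hj hj' ↦ by
  obtain ⟨hL, hη⟩ := hT j (by lia) η rfl
  have h1 : Ξ j = ⟨(v ^ (j : ℕ))⁻¹ η, hL⟩ := Subtype.ext (h j hj hj')
  rw [blockDiag_apply, fold_of_le (by lia), h1, hη]

theorem Tracks.blockDiag_inv (h : Tracks v N L d η Ξ) (hT : Agrees u v N L u' {u⁻¹ η}) :
    Tracks v N L d (u⁻¹ η) ((SoftTorus.blockDiag N u')⁻¹ Ξ) := fun j hj hj' ↦ by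
  obtain ⟨hL, hη⟩ := hT j (by lia) _ rfl
  have h1 : u' j ⟨(v ^ (j : ℕ))⁻¹ (u⁻¹ η), hL⟩ = Ξ j := Subtype.ext <| by
    rw [hη, h j hj hj']
    exact congrArg _ (u.apply_symm_apply η)
  rw [blockDiag_inv_apply, fold_of_le (by lia), ← h1, LinearIsometryEquiv.symm_apply_apply]

/-- Coordinate `j` becomes `v⁻⁽ʲ⁻¹⁾ η = v⁻ʲ (v η)`; the window shrinks by one because the shift
brings in an untracked entry. -/
theorem Tracks.blockShift (h : Tracks v N L d η Ξ) :
    Tracks v N L (d + 1) (v η) (blockShift N L Ξ) := fun j hj hj' ↦ by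
  have h1 := coe_finRotate_symm_eq (show 1 ≤ (j : ℕ) by lia)
  rw [blockShift_apply, h _ (by lia) (by lia), h1]
  change _ = ((v ^ (j : ℕ))⁻¹ * v) η
  congr 1
  obtain ⟨k, hk⟩ : ∃ k, (j : ℕ) = k + 1 := ⟨j - 1, by lia⟩
  rw [hk, Nat.add_sub_cancel]
  group

theorem Tracks.blockShift_inv (h : Tracks v N L d η Ξ) :
    Tracks v N L (d + 1) (v⁻¹ η) ((SoftTorus.blockShift N L)⁻¹ Ξ) := fun j hj hj' ↦ by
  have h1 := coe_finRotate_eq (show (j : ℕ) ≤ N by lia)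
  rw [blockShift_inv_apply, h _ (by lia) (by lia), h1]
  change _ = ((v ^ (j : ℕ))⁻¹ * v⁻¹) η
  congr 1
  group

/-- The loss `r` and the finite set `T` depend only on the word and on `η`, so `N`, `L` and `u'` can
be chosen afterwards. Arbitrary `d` and `Ξ` are needed to compose words. -/
theorem exists_tracks_word (u v : H ≃ₗᵢ[ℂ] H) (g : FreeGroup (Fin 2)) :
    ∀ η : H, ∃ (r : ℕ) (T : Set H), T.Finite ∧
      ∀ (N : ℕ) (L : Submodule ℂ H) (u' : ℕ → L ≃ₗᵢ[ℂ] L), Agrees u v N L u' T → ∀ d Ξ,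
        Tracks v N L d η Ξ → Tracks v N L (d + r) (FreeGroup.lift ![u, v] g η)
          (FreeGroup.lift ![SoftTorus.blockDiag N u', SoftTorus.blockShift N L] g Ξ) := by
  induction g using FreeGroup.induction_on with
  | C1 => exact fun η ↦ ⟨0, ∅, Set.finite_empty, fun N L u' _ d Ξ h ↦ by simpa using h⟩
  | of i =>
    intro η
    fin_cases i
    · exact ⟨0, {η}, Set.finite_singleton η, fun N L u' hT d Ξ h ↦ by
        simpa using h.blockDiag hT⟩
    · exact ⟨1, ∅, Set.finite_empty, fun N L u' hT d Ξ h ↦ by simpa using h.blockShift⟩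
  | inv_of i _ =>
    intro η
    fin_cases i
    · exact ⟨0, {u⁻¹ η}, Set.finite_singleton _, fun N L u' hT d Ξ h ↦ by
        rw [map_inv, map_inv, FreeGroup.lift_apply_of, FreeGroup.lift_apply_of]
        exact h.blockDiag_inv hT⟩
    · exact ⟨1, ∅, Set.finite_empty, fun N L u' hT d Ξ h ↦ by
        rw [map_inv, map_inv, FreeGroup.lift_apply_of, FreeGroup.lift_apply_of]
        exact h.blockShift_inv⟩
  | mul x y hx hy =>
    intro η
    obtain ⟨r, T, hT, h⟩ := hy η
    obtain ⟨r', T', hT', h'⟩ := hx (FreeGroup.lift ![u, v] y η)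
    refine ⟨r + r', T ∪ T', hT.union hT', fun N L u' hA d Ξ hΞ ↦ ?_⟩
    rw [map_mul, map_mul, ← add_assoc]
    exact h' N L u' (hA.mono Set.subset_union_right) _ _
      (h N L u' (hA.mono Set.subset_union_left) _ _ hΞ)

end Tracking

open FreeStarAlg

/-! ### Representations of the free `*`-algebra and norm comparison -/

section Free

variable {H : Type*} [NormedAddCommGroup H] [InnerProductSpace ℂ H] [CompleteSpace H]

/-- The pair of elements of the unitary group given by two unitary operators. -/
def unitaryPair (u v : H ≃ₗᵢ[ℂ] H) (i : Fin 2) : unitary (H →L[ℂ] H) :=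
  Unitary.linearIsometryEquiv.symm (![u, v] i)

/-- The representation of `ℂ[F₂]` determined by two unitary operators. -/
def pairRep (u v : H ≃ₗᵢ[ℂ] H) : FreeStarAlg →⋆ₐ[ℂ] (H →L[ℂ] H) := freeLift (unitaryPair u v)

theorem pairRep_single (u v : H ≃ₗᵢ[ℂ] H) (g : FreeGroup (Fin 2)) (c : ℂ) (x : H) :
    pairRep u v (single g c) x = c • FreeGroup.lift ![u, v] g x := by
  have h : FreeGroup.lift (unitaryPair u v) =
      Unitary.linearIsometryEquiv.symm.toMonoidHom.comp (FreeGroup.lift ![u, v]) := by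
    ext1 i
    simp [unitaryPair]
  rw [pairRep, freeLift_single, h]
  rfl

end Free

variable {H : Type*} [NormedAddCommGroup H] [InnerProductSpace ℂ H] [CompleteSpace H]

theorem sum_ite_mem_Icc (c : ℕ) {d n : ℕ} (hd : d < n) (t : ℝ) :
    ∑ j : Fin n, (if c ≤ (j : ℕ) ∧ (j : ℕ) ≤ d then t else 0) = (d + 1 - c : ℕ) * t := by
  rw [Fin.sum_univ_eq_sum_range (fun k ↦ if c ≤ k ∧ k ≤ d then t else 0), ← Finset.sum_filter]
  have h : (Finset.range n).filter (fun k ↦ c ≤ k ∧ k ≤ d) = Finset.Icc c d := by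
    ext k
    simp only [Finset.mem_filter, Finset.mem_range, Finset.mem_Icc]
    lia
  rw [h, Finset.sum_const, Nat.card_Icc, nsmul_eq_mul]

theorem exists_tracks (u v : H ≃ₗᵢ[ℂ] H) (b : FreeStarAlg) (η : H) :
    ∃ (r : ℕ) (T : Set H), T.Finite ∧
      ∀ (N : ℕ) (L : Submodule ℂ H) (_ : CompleteSpace L) (u' : ℕ → L ≃ₗᵢ[ℂ] L),
        Agrees u v N L u' T → ∀ Ξ, Tracks v N L 0 η Ξ →
          Tracks v N L r (pairRep u v b η)
            (pairRep (blockDiag N u') (blockShift N L) b Ξ) := by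
  induction b using FreeStarAlg.induction with
  | hadd x y hx hy =>
    obtain ⟨r, T, hT, h⟩ := hx
    obtain ⟨r', T', hT', h'⟩ := hy
    refine ⟨max r r', T ∪ T', hT.union hT', fun N L _ u' hA Ξ hΞ ↦ ?_⟩
    rw [map_add, map_add]
    exact ((h N L ‹_› u' (hA.mono Set.subset_union_left) Ξ hΞ).mono (le_max_left _ _)).add
      ((h' N L ‹_› u' (hA.mono Set.subset_union_right) Ξ hΞ).mono (le_max_right _ _))
  | hsingle g c =>
    obtain ⟨r, T, hT, h⟩ := exists_tracks_word u v g η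
    refine ⟨r, T, hT, fun N L _ u' hA Ξ hΞ ↦ ?_⟩
    rw [pairRep_single, pairRep_single]
    have := h N L u' hA 0 Ξ hΞ
    rw [zero_add] at this
    exact this.smul c

/-- A finite-dimensional pair of unitaries commuting up to `ε` approximates a given one, up to a
factor `2` in norm, on a given element of the free `*`-algebra and a given vector. -/
theorem exists_finiteDimensional_norm_le.{u} {H : Type u} [NormedAddCommGroup H]
    [InnerProductSpace ℂ H] [CompleteSpace H] {ε : ℝ} (hε : 0 ≤ ε) (u v : H ≃ₗᵢ[ℂ] H)
    (huv : ∀ x, ‖u (v x) - v (u x)‖ ≤ ε * ‖x‖) (b : FreeStarAlg) (η : H) :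
    ∃ (E : Type u) (_ : NormedAddCommGroup E) (_ : InnerProductSpace ℂ E)
      (_ : FiniteDimensional ℂ E) (_ : CompleteSpace E) (U V : E ≃ₗᵢ[ℂ] E),
      (∀ x, ‖U (V x) - V (U x)‖ ≤ ε * ‖x‖) ∧
      ‖pairRep u v b η‖ ≤ 2 * ‖pairRep U V b‖ * ‖η‖ := by
  obtain ⟨r, T, hT, h⟩ := exists_tracks u v b η
  -- The input has `4r + 1` nonzero slots (if `η ≠ 0`), and the tracked window `[r, 3r]` has `2r +
  -- 1`; their ratio stays below `4 = 2²`.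
  let N := 4 * r
  -- `u_n` sends `v⁻ⁿ x` to `v⁻ⁿ (u x)`, so a copy exact on these vectors gives `Agrees`.
  let S : Set H := ⋃ n ∈ Finset.range (N + 1), (fun x ↦ (v ^ n)⁻¹ x) '' (insert η T)
  have hS : S.Finite := Set.Finite.biUnion (Finset.finite_toSet _) fun n _ ↦ (hT.insert η).image _
  have hSmem : ∀ n ≤ N, ∀ x ∈ insert η T, (v ^ n)⁻¹ x ∈ Submodule.span ℂ S := fun n hn x hx ↦
    Submodule.subset_span (Set.mem_biUnion (Finset.mem_coe.mpr (Finset.mem_range.mpr (by lia)))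
      ⟨x, hx, rfl⟩)
  have := FiniteDimensional.span_of_finite ℂ hS
  obtain ⟨L, hL, hSL, hchain⟩ := exists_finiteDimensional_chain hε
    (fun n ↦ (v ^ n)⁻¹ * u * v ^ n) (fun n x ↦ by
      have h1 := huv ((v ^ n) x)
      have h2 : (v ^ (n + 1))⁻¹ * u * v ^ (n + 1) = (v ^ (n + 1))⁻¹ * (u * v * v ^ n) := by
        rw [pow_succ']
        group
      have h3 : (v ^ n)⁻¹ * u * v ^ n = (v ^ (n + 1))⁻¹ * (v * u * v ^ n) := by
        rw [pow_succ']
        group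
      rw [h2, h3]
      rw [LinearIsometryEquiv.norm_map, ← LinearIsometryEquiv.norm_map (v ^ (n + 1))⁻¹,
        map_sub] at h1
      exact h1) (Submodule.span ℂ S) N
  obtain ⟨u', hstep, hu'⟩ := hchain L hL le_rfl
  have hA : Agrees u v N L u' (insert η T) := fun n hn x hx ↦ by
    obtain ⟨hxL, hx'⟩ := hu' n hn _ (hSmem n hn x hx)
    refine ⟨hxL, hx'.trans ?_⟩
    change ((v ^ n)⁻¹ * u * v ^ n * (v ^ n)⁻¹) x = ((v ^ n)⁻¹ * u) x
    rw [mul_inv_cancel_right]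
  let Ξ : PiLp 2 (fun _ : Fin (2 * N + 2) ↦ L) := WithLp.toLp 2 fun j ↦
    if hj : (j : ℕ) ≤ N then ⟨(v ^ (j : ℕ))⁻¹ η, (hA j hj η (Set.mem_insert _ _)).1⟩ else 0
  have hΞ : Tracks v N L 0 η Ξ := fun j _ hj ↦ by
    have hj : (j : ℕ) ≤ N := hj
    simp [Ξ, hj]
  have htr := h N L inferInstance u' (hA.mono (Set.subset_insert _ _)) Ξ hΞ
  refine ⟨PiLp 2 (fun _ : Fin (2 * N + 2) ↦ L), inferInstance, inferInstance, inferInstance,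
    inferInstance, blockDiag N u', blockShift N L,
    norm_blockDiag_blockShift_sub_le hε N u' hstep, ?_⟩
  set R := pairRep (blockDiag N u') (blockShift N L) b
  set y := pairRep u v b η
  have hnΞ : ‖Ξ‖ ^ 2 = (N + 1) * ‖η‖ ^ 2 := by
    have h1 : ∀ j, ‖Ξ j‖ ^ 2 = if 0 ≤ (j : ℕ) ∧ (j : ℕ) ≤ N then ‖η‖ ^ 2 else 0 := fun j ↦ by
      by_cases hj : (j : ℕ) ≤ N
      · rw [Submodule.coe_norm, hΞ j (Nat.zero_le _) hj, LinearIsometryEquiv.norm_map]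
        simp [hj]
      · simp [Ξ, hj]
    rw [PiLp.norm_sq_eq_of_L2, Finset.sum_congr rfl fun j _ ↦ h1 j,
      sum_ite_mem_Icc _ (by lia : N < 2 * N + 2)]
    push_cast
    ring
  have hny : (2 * r + 1) * ‖y‖ ^ 2 ≤ ‖R Ξ‖ ^ 2 := by
    have h1 := sum_ite_mem_Icc r (by lia : 3 * r < 2 * N + 2) (‖y‖ ^ 2)
    rw [show ((3 * r + 1 - r : ℕ) : ℝ) = 2 * r + 1 by
      rw [show 3 * r + 1 - r = 2 * r + 1 by lia]
      push_cast
      rfl] at h1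
    rw [PiLp.norm_sq_eq_of_L2, ← h1]
    refine Finset.sum_le_sum fun j _ ↦ ?_
    split_ifs with hj
    · rw [Submodule.coe_norm, htr j hj.1 (by lia), LinearIsometryEquiv.norm_map]
    -- Coordinates outside the window are uncontrolled and are dropped.
    · positivity
  have hR := pow_le_pow_left₀ (norm_nonneg _) (R.le_opNorm Ξ) 2
  rw [← sq_le_sq₀ (norm_nonneg _) (by positivity)]
  rw [mul_pow, hnΞ] at hR
  have hN : (N : ℝ) = 4 * r := by simp [N]
  rw [hN] at hR
  have h0 : 0 ≤ ‖R‖ ^ 2 * ‖η‖ ^ 2 := by positivity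
  have hr : (0 : ℝ) ≤ r := r.cast_nonneg
  have h1 : (2 * r + 1) * ‖y‖ ^ 2 ≤ (2 * r + 1) * (2 * ‖R‖ * ‖η‖) ^ 2 := by
    nlinarith [mul_nonneg hr h0]
  exact le_of_mul_le_mul_left h1 (by positivity)

/-- A finite-dimensional Hilbert space representation is a matrix representation. -/
theorem exists_matrix_hom {A : Type*} [NonUnitalCStarAlgebra A] {E : Type*} [NormedAddCommGroup E]
    [InnerProductSpace ℂ E] [FiniteDimensional ℂ E] [CompleteSpace E] (ρ : A →⋆ₙₐ[ℂ] (E →L[ℂ] E))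
    {a : A} (ha : ρ a ≠ 0) :
    ∃ (n : ℕ) (π : A →⋆ₙₐ[ℂ] Matrix (Fin n) (Fin n) ℂ), π a ≠ 0 := by
  let e := LinearMap.toMatrixOrthonormal (stdOrthonormalBasis ℂ E)
  let f : (E →L[ℂ] E) →⋆ₙₐ[ℂ] Matrix (Fin (Module.finrank ℂ E)) (Fin (Module.finrank ℂ E)) ℂ :=
    { toFun := fun x ↦ e x.toLinearMap
      map_smul' := fun c x ↦ map_smul e c x.toLinearMap
      map_zero' := map_zero e
      map_add' := fun x y ↦ map_add e x.toLinearMap y.toLinearMap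
      map_mul' := fun x y ↦ map_mul e x.toLinearMap y.toLinearMap
      map_star' := fun x ↦ by
        rw [← map_star e]
        rfl }
  refine ⟨_, f.comp ρ, fun h ↦ ha ?_⟩
  have h1 : (ρ a).toLinearMap = 0 := e.injective (h.trans (map_zero e).symm)
  exact ContinuousLinearMap.coe_injective h1

theorem norm_unitaryPair_commutator_le {ε : ℝ} (hε : 0 ≤ ε) (u v : H ≃ₗᵢ[ℂ] H)
    (huv : ∀ x, ‖u (v x) - v (u x)‖ ≤ ε * ‖x‖) :
    ‖(unitaryPair u v 0 * unitaryPair u v 1 - unitaryPair u v 1 * unitaryPair u v 0 :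
      H →L[ℂ] H)‖ ≤ ε :=
  ContinuousLinearMap.opNorm_le_bound _ hε huv

end SoftTorus

/-! ### Residual finite-dimensionality -/

open SoftTorus

theorem mainTheorem9 (ε : ℝ) (hε : 0 ≤ ε) : IsRFD (SoftTorus ε) := by
  intro a ha
  obtain ⟨H, _, _, _, π, η, hη⟩ := CStarAlgebra.exists_representation_apply_ne_zero ha
  let W : Fin 2 → unitary (H →L[ℂ] H) := fun i ↦
    ⟨π (SoftTorus.gen ε i), Unitary.map_mem π (gen_mem_unitary ε i)⟩
  let u := Unitary.linearIsometryEquiv (W 0)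
  let v := Unitary.linearIsometryEquiv (W 1)
  have hW : unitaryPair u v = W := by
    funext i
    fin_cases i <;> exact Unitary.linearIsometryEquiv.symm_apply_apply _
  have hcomm : ‖π (SoftTorus.gen ε 0 * SoftTorus.gen ε 1 - SoftTorus.gen ε 1 * SoftTorus.gen ε 0)‖
      ≤ ε := (NonUnitalStarAlgHom.norm_apply_le π _).trans (norm_commutator_gen_le hε)
  have huv : ∀ x, ‖u (v x) - v (u x)‖ ≤ ε * ‖x‖ := fun x ↦ by
    rw [map_sub, map_mul, map_mul] at hcomm
    exact ContinuousLinearMap.le_of_opNorm_le _ hcomm x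
  have hπ : ∀ b, π (ofFree ε b) = pairRep u v b := fun b ↦ by
    have hle := norm_unitaryPair_commutator_le hε u v huv
    rw [pairRep, ← lift_ofFree _ hle]
    refine congrArg (fun φ : SoftTorus ε →⋆ₐ[ℂ] (H →L[ℂ] H) ↦ φ (ofFree ε b)) (hom_ext fun i ↦ ?_)
    rw [lift_gen, hW]
  have hη0 : 0 < ‖η‖ := norm_pos_iff.mpr fun h ↦ hη (by rw [h, map_zero])
  -- If `ρ a = 0`, then `‖b(U, V)‖ ≤ δ`, so `‖π a η‖ ≤ δ‖η‖ + 2δ‖η‖`; the choice of `δ` excludes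
  -- this.
  obtain ⟨δ, hδ, hδη⟩ : ∃ δ : ℝ, 0 < δ ∧ 3 * δ * ‖η‖ < ‖π a η‖ :=
    have := norm_pos_iff.mpr hη
    ⟨‖π a η‖ / (4 * ‖η‖), by positivity, by
      field_simp
      linarith⟩
  obtain ⟨b, hb⟩ := denseRange_ofFree.exists_dist_lt a hδ
  rw [dist_eq_norm] at hb
  obtain ⟨E, _, _, _, _, U, V, hUV, hE⟩ := exists_finiteDimensional_norm_le hε u v huv b η
  let ρ := lift _ (norm_unitaryPair_commutator_le hε U V hUV)
  refine exists_matrix_hom (ρ : SoftTorus ε →⋆ₙₐ[ℂ] (E →L[ℂ] E)) (a := a) fun hρ ↦ ?_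
  replace hρ : ρ a = 0 := hρ
  have h1 : ‖π (a - ofFree ε b) η‖ ≤ δ * ‖η‖ :=
    ContinuousLinearMap.le_of_opNorm_le _ ((NonUnitalStarAlgHom.norm_apply_le π _).trans hb.le) η
  have h2 : ‖ρ (a - ofFree ε b)‖ ≤ δ := (NonUnitalStarAlgHom.norm_apply_le ρ _).trans hb.le
  rw [map_sub, hρ, zero_sub, norm_neg, lift_ofFree] at h2
  replace h2 : ‖pairRep U V b‖ ≤ δ := h2
  rw [map_sub, sub_apply, hπ] at h1
  have h3 := norm_sub_norm_le (π a η) (pairRep u v b η)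
  have h4 := mul_le_mul_of_nonneg_right h2 hη0.le
  linarith

end
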